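/- For every $\varepsilon>0$ there is a constant $C=C(\varepsilon)>0$, depending only on $\varepsilon$, such that the following holds for all real numbers $N\ge 1$, $Q\ge 1$, $Q_1\ge 1$ and every sequence $(a_n)_{n\ge 1}$ of complex numbers. Put $$S(\alpha)=\sum_{1\le n\le N} a_n e^{2\pi i n\alpha}\quad(\alpha\in\mathbb{R}),\qquad Z=\sum_{1\le n\le N}|a_n|^2 .$$ Then $$\sum_{1\le q\le Q_1}\ \sum_{\substack{1\le a\le q^2\\ (a,q)=1}}\left|S\!\left(\frac{a}{q^2}\right)\right|^2\ \le\ C\,(\log\log 10NQ)^2\left(Q_1^3+N+N^{1/2+\varepsilon}Q_1^2\right)Z .$$ (In particular one may take $Q=Q_1$.) -/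

import Mathlib

noncomputable section

/-- The exponential sum `S(α) = ∑_{n ≤ N} a_n e(nα)`, where `e(x) = exp(2πix)` and `n` runs over
the positive integers not exceeding the real number `N`. -/
def expSum (a : ℕ → ℂ) (N : ℝ) (α : ℝ) : ℂ :=
  ∑ n ∈ Finset.Icc 1 ⌊N⌋₊, a n * Complex.exp (2 * Real.pi * Complex.I * (n * α))

/-- `Z = ∑_{n ≤ N} |a_n|²`. -/
def sqNormSum (a : ℕ → ℂ) (N : ℝ) : ℝ :=
  ∑ n ∈ Finset.Icc 1 ⌊N⌋₊, ‖a n‖ ^ 2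

/-- The large sieve sum for square moduli:
`∑_{1 ≤ q ≤ Q₁} ∑_{1 ≤ b ≤ q², (b, q) = 1} |S(b/q²)|²`. -/
def squareSieveSum (a : ℕ → ℂ) (N Q₁ : ℝ) : ℝ :=
  ∑ q ∈ Finset.Icc 1 ⌊Q₁⌋₊, ∑ b ∈ Finset.Icc 1 (q ^ 2) with Nat.Coprime b q,
    ‖expSum a N ((b : ℝ) / (q : ℝ) ^ 2)‖ ^ 2

end

/-! A large sieve sum is controlled by how densely its points cluster. By Gallagher's argument, if
every interval of length `1 / M`, with `M ≥ N`, contains at most `K` points, then the sum is at most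
`42 K M Z`. It remains to count fractions `b / q²` with `q ≤ Q₁` in an interval `[c, c + δ]`, where
`δ = 1 / M` and `M` is of the size of `N`.

Elementary spacing settles `M ≤ Q₁²` and `M > Q₁⁴`. Between these, Dirichlet gives `p / r` close to
`c` with `r ≤ √M`, and the fractions are sorted by `m = b r - p q²`. Only one reduced fraction has
`m = 0`. For fixed `m ≠ 0`, the denominator `q` solves `p q² ≡ -m (mod r)` and is confined to a
short interval, so there are about `τ(r) (1 + gcd(m, r) L / r)` choices. Summing over `m` according
to `gcd(m, r)` costs another `τ(r)`, and the divisor bound turns `τ(r)²` into `M ^ ε`.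

This gives the estimate with no `log log` factor; since that factor squared is at least `1 / 4`, it
is absorbed into the constant. -/

/-! ### Gallagher's form of the large sieve -/

/-- A bound for the value of `‖f‖²` at a point of an interval by mean values over the interval. -/
theorem mul_norm_sq_le_integral {f f' : ℝ → ℂ} (hf : ∀ x, HasDerivAt f (f' x) x)
    (hf' : Continuous f') {c δ α : ℝ} (hδ : 0 < δ) (hα : α ∈ Set.Icc c (c + δ)) :
    δ * ‖f α‖ ^ 2 ≤
      2 * (∫ t in c..c + δ, ‖f t‖ ^ 2) + δ ^ 2 * ∫ t in c..c + δ, ‖f' t‖ ^ 2 := by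
  have hfc : Continuous f := continuous_iff_continuousAt.2 fun x => (hf x).continuousAt
  have hle : c ≤ c + δ := by linarith
  have hg : ∀ x, HasDerivAt (fun t => ‖f t‖ ^ 2) (2 * inner ℝ (f x) (f' x)) x :=
    fun x => (hf x).norm_sq
  have hgc : Continuous fun t => 2 * inner ℝ (f t) (f' t) := by fun_prop
  have hbound : ∀ x, δ * |2 * inner ℝ (f x) (f' x)| ≤ ‖f x‖ ^ 2 + δ ^ 2 * ‖f' x‖ ^ 2 := by
    intro x
    have h := abs_real_inner_le_norm (f x) (f' x)
    rw [abs_mul, abs_two]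
    nlinarith [sq_nonneg (‖f x‖ - δ * ‖f' x‖)]
  set V := ∫ t in c..c + δ, |2 * inner ℝ (f t) (f' t)| with hV
  have hVle : δ * V ≤ (∫ t in c..c + δ, ‖f t‖ ^ 2) + δ ^ 2 * ∫ t in c..c + δ, ‖f' t‖ ^ 2 := by
    rw [hV, ← intervalIntegral.integral_const_mul, ← intervalIntegral.integral_const_mul,
      ← intervalIntegral.integral_add]
    · apply intervalIntegral.integral_mono_on hle
      · exact Continuous.intervalIntegrable (by fun_prop) _ _
      · exact Continuous.intervalIntegrable (by fun_prop) _ _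
      · exact fun x _ => hbound x
    · exact Continuous.intervalIntegrable (by fun_prop) _ _
    · exact Continuous.intervalIntegrable (by fun_prop) _ _
  -- `V` bounds the variation of `‖f‖²` on the interval; averaging this over `t` gives the claim.
  have hpt : ∀ t ∈ Set.Icc c (c + δ), ‖f α‖ ^ 2 ≤ ‖f t‖ ^ 2 + V := by
    intro t ht
    have h1 : ∫ s in t..α, 2 * inner ℝ (f s) (f' s) = ‖f α‖ ^ 2 - ‖f t‖ ^ 2 :=
      intervalIntegral.integral_eq_sub_of_hasDerivAt (fun x _ => hg x)
        (hgc.intervalIntegrable _ _)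
    have h2 : |∫ s in t..α, 2 * inner ℝ (f s) (f' s)| ≤ V := by
      refine (intervalIntegral.norm_integral_le_integral_norm_uIoc
        (f := fun s => 2 * inner ℝ (f s) (f' s)) (μ := MeasureTheory.volume)).trans ?_
      rw [hV, intervalIntegral.integral_of_le hle]
      apply MeasureTheory.setIntegral_mono_set
      · exact (hgc.abs.continuousOn.integrableOn_Icc).mono_set Set.Ioc_subset_Icc_self
      · exact Filter.Eventually.of_forall fun _ => abs_nonneg _
      · refine LE.le.eventuallyLE (?_ : Set.uIoc t α ⊆ Set.Ioc c (c + δ))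
        intro s hs
        rw [Set.mem_uIoc] at hs
        rcases hs with hs | hs
        · exact ⟨ht.1.trans_lt hs.1, hs.2.trans hα.2⟩
        · exact ⟨hα.1.trans_lt hs.1, hs.2.trans ht.2⟩
    have h3 := (le_abs_self _).trans h2
    linarith
  have hint : ∫ _ in c..c + δ, ‖f α‖ ^ 2 ≤ ∫ t in c..c + δ, (‖f t‖ ^ 2 + V) := by
    apply intervalIntegral.integral_mono_on hle
    · exact Continuous.intervalIntegrable (by fun_prop) _ _
    · exact Continuous.intervalIntegrable (by fun_prop) _ _
    · exact hpt
  rw [intervalIntegral.integral_add (Continuous.intervalIntegrable (by fun_prop) _ _)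
    (Continuous.intervalIntegrable (by fun_prop) _ _), intervalIntegral.integral_const,
    intervalIntegral.integral_const, smul_eq_mul, smul_eq_mul, add_sub_cancel_left] at hint
  linarith

theorem hasDerivAt_expSum (a : ℕ → ℂ) (N α : ℝ) :
    HasDerivAt (expSum a N) (expSum (fun n => 2 * Real.pi * Complex.I * n * a n) N α) α := by
  unfold expSum
  apply HasDerivAt.fun_sum
  intro n _
  have h : HasDerivAt (fun x : ℝ => 2 * Real.pi * Complex.I * (n * (x : ℂ)))
      (2 * Real.pi * Complex.I * (n * 1)) α :=
    ((HasDerivAt.ofReal_comp (hasDerivAt_id α)).const_mul _).const_mul _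
  convert! h.cexp.const_mul (a n) using 1
  ring

theorem continuous_expSum (a : ℕ → ℂ) (N : ℝ) : Continuous (expSum a N) :=
  continuous_iff_continuousAt.2 fun α => (hasDerivAt_expSum a N α).continuousAt

theorem integral_cexp_two_pi_int (k : ℤ) :
    ∫ x in (0 : ℝ)..1, Complex.exp (2 * Real.pi * Complex.I * (k * x)) = if k = 0 then 1 else 0 := by
  split_ifs with hk
  · simp [hk]
  · have hc : (2 * Real.pi * Complex.I * k : ℂ) ≠ 0 := by
      simp [Real.pi_ne_zero, hk]
    have h := integral_exp_mul_complex (a := 0) (b := 1) hc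
    simp only [mul_assoc] at h ⊢
    rw [h]
    have h1 : Complex.exp (2 * (Real.pi * (Complex.I * (k * (1 : ℝ))))) = 1 := by
      rw [Complex.exp_eq_one_iff]
      exact ⟨k, by push_cast; ring⟩
    rw [h1]
    simp

theorem integral_norm_sq_expSum (a : ℕ → ℂ) (N : ℝ) :
    ∫ x in (0 : ℝ)..1, ‖expSum a N x‖ ^ 2 = sqNormSum a N := by
  have key : ∀ x : ℝ, ((‖expSum a N x‖ ^ 2 : ℝ) : ℂ) =
      ∑ m ∈ Finset.Icc 1 ⌊N⌋₊, ∑ n ∈ Finset.Icc 1 ⌊N⌋₊, a m * (starRingEnd ℂ) (a n) *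
        Complex.exp (2 * Real.pi * Complex.I * (((m : ℤ) - n : ℤ) * x)) := by
    intro x
    push_cast
    rw [← Complex.mul_conj', expSum, map_sum, Finset.sum_mul_sum]
    refine Finset.sum_congr rfl fun m _ => Finset.sum_congr rfl fun n _ => ?_
    rw [map_mul, ← Complex.exp_conj, mul_mul_mul_comm, ← Complex.exp_add]
    congr 2
    simp [Complex.conj_ofNat]
    ring
  have hcont : ∀ k : ℤ, Continuous fun x : ℝ => Complex.exp (2 * Real.pi * Complex.I * (k * x)) :=
    fun k => by fun_prop
  apply Complex.ofReal_injective
  rw [← intervalIntegral.integral_ofReal]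
  simp_rw [key]
  rw [intervalIntegral.integral_finsetSum]
  · simp_rw [sqNormSum, Complex.ofReal_sum]
    refine Finset.sum_congr rfl fun m hm => ?_
    rw [intervalIntegral.integral_finsetSum]
    · simp_rw [intervalIntegral.integral_const_mul, integral_cexp_two_pi_int]
      rw [Finset.sum_eq_single m]
      · simp [Complex.mul_conj']
      · intro n _ hn
        rw [if_neg, mul_zero]
        omega
      · exact fun h => absurd hm h
    · exact fun n _ => ((hcont _).const_smul (a m * (starRingEnd ℂ) (a n))).intervalIntegrable _ _
  · exact fun m _ => (continuous_finsetSum _ fun n _ =>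
      ((hcont _).const_smul (a m * (starRingEnd ℂ) (a n)))).intervalIntegrable _ _

theorem sqNormSum_nonneg (a : ℕ → ℂ) (N : ℝ) : 0 ≤ sqNormSum a N :=
  Finset.sum_nonneg fun _ _ => by positivity

theorem sqNormSum_deriv_le (a : ℕ → ℂ) {N : ℝ} (hN : 0 ≤ N) :
    sqNormSum (fun n => 2 * Real.pi * Complex.I * n * a n) N ≤ 40 * N ^ 2 * sqNormSum a N := by
  unfold sqNormSum
  rw [Finset.mul_sum]
  refine Finset.sum_le_sum fun n hn => ?_
  have hn' : (n : ℝ) ≤ N := (Nat.le_floor_iff hN).1 (Finset.mem_Icc.1 hn).2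
  have hpi : Real.pi ^ 2 ≤ 10 := by nlinarith [Real.pi_lt_d2, Real.pi_pos]
  simp only [norm_mul, Complex.norm_I, Complex.norm_natCast, Complex.norm_real, mul_one,
    Real.norm_eq_abs, abs_of_pos Real.pi_pos, Complex.norm_ofNat]
  have h2 : (n : ℝ) ^ 2 ≤ N ^ 2 := by gcongr
  calc (2 * Real.pi * n * ‖a n‖) ^ 2 = 4 * (Real.pi ^ 2 * (n : ℝ) ^ 2) * ‖a n‖ ^ 2 := by ring
    _ ≤ 4 * (10 * N ^ 2) * ‖a n‖ ^ 2 := by gcongr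
    _ = _ := by ring

/-- The large sieve inequality for points of which at most `K` lie in any interval of
length `1 / M`. -/
theorem sum_norm_sq_expSum_le {ι : Type*} (a : ℕ → ℂ) {N : ℝ} (hN : 0 ≤ N) {M : ℕ} (hM : 0 < M)
    (hNM : N ≤ M) (T : Finset ι) (x : ι → ℝ) (hx : ∀ i ∈ T, x i ∈ Set.Ioc 0 1) {K : ℝ}
    (hK : ∀ c : ℝ, ∀ A ⊆ T, (∀ i ∈ A, x i ∈ Set.Icc c (c + 1 / M)) → (A.card : ℝ) ≤ K) :
    ∑ i ∈ T, ‖expSum a N (x i)‖ ^ 2 ≤ 42 * (K * M) * sqNormSum a N := by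
  classical
  have hM0 : (0 : ℝ) < M := by exact_mod_cast hM
  have hK0 : 0 ≤ K := by simpa using hK 0 ∅ (by simp) (by simp)
  set a' : ℕ → ℂ := fun n => 2 * Real.pi * Complex.I * n * a n
  -- The pointwise bound with `δ = 1 / M`, divided by `δ`.
  set F : ℝ → ℝ := fun t => 2 * M * ‖expSum a N t‖ ^ 2 + 1 / M * ‖expSum a' N t‖ ^ 2 with hF
  have hc1 := continuous_expSum a N
  have hc2 := continuous_expSum a' N
  have hFc : Continuous F := by fun_prop
  have hF0 : ∀ t, 0 ≤ F t := fun t => by positivity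
  have hloc : ∀ c α, α ∈ Set.Icc c (c + 1 / (M : ℝ)) →
      ‖expSum a N α‖ ^ 2 ≤ ∫ t in c..c + 1 / (M : ℝ), F t := by
    intro c α hα
    have h := mul_norm_sq_le_integral (hasDerivAt_expSum a N) hc2 (by positivity) hα
    rw [intervalIntegral.integral_add (Continuous.intervalIntegrable (by fun_prop) _ _)
      (Continuous.intervalIntegrable (by fun_prop) _ _), intervalIntegral.integral_const_mul,
      intervalIntegral.integral_const_mul]
    rw [one_div_mul_eq_div, div_le_iff₀ hM0] at h
    refine h.trans (le_of_eq ?_)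
    simp only [a']
    field_simp
  -- Index of the cell `(j / M, (j + 1) / M]` containing `x i`; being closed on the right, the cells
  -- put `x i = 1` in the last one.
  set J : ι → ℕ := fun i => ⌈(M : ℝ) * x i⌉₊ - 1 with hJ
  have hJx : ∀ i ∈ T, J i < M ∧ x i ∈ Set.Icc ((J i : ℝ) / M) (J i / M + 1 / M) := by
    intro i hi
    obtain ⟨h0, h1⟩ := hx i hi
    have hpos : 0 < (M : ℝ) * x i := by positivity
    have hc : 0 < ⌈(M : ℝ) * x i⌉₊ := Nat.ceil_pos.2 hpos
    have hcM : ⌈(M : ℝ) * x i⌉₊ ≤ M := by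
      apply Nat.ceil_le.2
      nlinarith
    have hJ1 : ((J i : ℕ) : ℝ) = (⌈(M : ℝ) * x i⌉₊ : ℝ) - 1 := by
      rw [hJ]; push_cast [Nat.cast_sub hc]; ring
    have hlt := Nat.ceil_lt_add_one hpos.le
    have hle := Nat.le_ceil ((M : ℝ) * x i)
    refine ⟨by simp only [hJ]; omega, ?_, ?_⟩
    · rw [div_le_iff₀ hM0]; linarith
    · rw [← add_div, le_div_iff₀ hM0]; linarith
  -- Parseval: `42 = 2 + 40`, where `40` bounds the `4π²` produced by differentiation.
  have hFint : ∫ t in (0 : ℝ)..1, F t ≤ 42 * M * sqNormSum a N := by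
    rw [intervalIntegral.integral_add (Continuous.intervalIntegrable (by fun_prop) _ _)
      (Continuous.intervalIntegrable (by fun_prop) _ _), intervalIntegral.integral_const_mul,
      intervalIntegral.integral_const_mul, integral_norm_sq_expSum, integral_norm_sq_expSum]
    have h1 := sqNormSum_deriv_le a hN
    have h2 : 40 * N ^ 2 * sqNormSum a N ≤ 40 * (M : ℝ) ^ 2 * sqNormSum a N := by
      have := sqNormSum_nonneg a N
      gcongr
    have h3 : 1 / (M : ℝ) * sqNormSum a' N ≤ 1 / M * (40 * (M : ℝ) ^ 2 * sqNormSum a N) := by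
      have := h1.trans h2
      gcongr
    have h4 : 1 / (M : ℝ) * (40 * (M : ℝ) ^ 2 * sqNormSum a N) = 40 * M * sqNormSum a N := by
      field_simp
    linarith
  have hsum : ∑ j ∈ Finset.range M, ∫ t in (j : ℝ) / M..j / M + 1 / M, F t =
      ∫ t in (0 : ℝ)..1, F t := by
    have h := intervalIntegral.sum_integral_adjacent_intervals (μ := MeasureTheory.volume) (f := F)
      (a := fun j : ℕ => (j : ℝ) / M) (n := M) fun k _ => hFc.intervalIntegrable _ _
    simp only [Nat.cast_add, Nat.cast_one, Nat.cast_zero, zero_div, div_self hM0.ne',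
      add_div] at h
    exact h
  calc ∑ i ∈ T, ‖expSum a N (x i)‖ ^ 2
      = ∑ j ∈ Finset.range M, ∑ i ∈ T with J i = j, ‖expSum a N (x i)‖ ^ 2 :=
        (Finset.sum_fiberwise_of_maps_to (fun i hi => Finset.mem_range.2 (hJx i hi).1) _).symm
    _ ≤ ∑ j ∈ Finset.range M, K * ∫ t in (j : ℝ) / M..j / M + 1 / M, F t := by
        refine Finset.sum_le_sum fun j _ => ?_
        have hmem : ∀ i ∈ T.filter (J · = j), x i ∈ Set.Icc ((j : ℝ) / M) (j / M + 1 / M) := by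
          intro i hi
          rw [Finset.mem_filter] at hi
          exact hi.2 ▸ (hJx i hi.1).2
        refine (Finset.sum_le_card_nsmul _ _ _ fun i hi => hloc _ _ (hmem i hi)).trans ?_
        rw [nsmul_eq_mul]
        have h0 : 0 ≤ ∫ t in (j : ℝ) / M..j / M + 1 / M, F t :=
          intervalIntegral.integral_nonneg (by simp) fun t _ => hF0 t
        exact mul_le_mul_of_nonneg_right (hK _ _ (Finset.filter_subset _ _) hmem) h0
    _ = K * ∫ t in (0 : ℝ)..1, F t := by rw [← Finset.mul_sum, hsum]
    _ ≤ K * (42 * M * sqNormSum a N) := by gcongr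
    _ = _ := by ring


/-! ### Counting in progressions and solutions of a quadratic congruence -/

theorem card_le_of_dvd_sub {B : Finset ℕ} {s : ℕ} (hs : 0 < s) {L : ℝ} (hL : 0 ≤ L)
    (hB : ∀ x ∈ B, ∀ y ∈ B, x ≤ y → s ∣ y - x ∧ (y : ℝ) - x ≤ L) :
    (B.card : ℝ) ≤ L / s + 1 := by
  rcases B.eq_empty_or_nonempty with rfl | hne
  · simp; positivity
  set x₀ := B.min' hne
  have hx₀ : x₀ ∈ B := B.min'_mem hne
  have hmin : ∀ y ∈ B, x₀ ≤ y := fun y hy => B.min'_le y hy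
  have hs' : (0 : ℝ) < s := by exact_mod_cast hs
  have hcard : B.card ≤ (Finset.range (⌊L / s⌋₊ + 1)).card := by
    apply Finset.card_le_card_of_injOn (fun y => (y - x₀) / s)
    · intro y hy
      have h := hB x₀ hx₀ y hy (hmin y hy)
      rw [Finset.mem_coe, Finset.mem_range, Nat.lt_succ_iff]
      apply Nat.le_floor
      rw [Nat.cast_div h.1 hs'.ne', Nat.cast_sub (hmin y hy)]
      exact div_le_div_of_nonneg_right h.2 hs'.le
    · intro y hy z hz hyz
      have h1 := Nat.div_mul_cancel (hB x₀ hx₀ y hy (hmin y hy)).1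
      have h2 := Nat.div_mul_cancel (hB x₀ hx₀ z hz (hmin z hz)).1
      simp only at hyz
      rw [hyz, h2] at h1
      have := hmin y hy
      have := hmin z hz
      omega
  rw [Finset.card_range] at hcard
  calc (B.card : ℝ) ≤ ((⌊L / s⌋₊ + 1 : ℕ) : ℝ) := by exact_mod_cast hcard
    _ ≤ L / s + 1 := by
      push_cast
      linarith [Nat.floor_le (show 0 ≤ L / (s : ℝ) by positivity)]

/-- Solutions `q` of `p q² ≡ -m (mod r)` with `p` prime to `r`, in an interval of length `L`. -/
theorem card_quadratic_congruence_le {B : Finset ℕ} {r : ℕ} (hr : 0 < r) {p m : ℤ}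
    (hp : IsCoprime (r : ℤ) p) (hB : ∀ q ∈ B, (r : ℤ) ∣ p * (q : ℤ) ^ 2 + m) {L : ℝ} (hL : 0 ≤ L)
    (hBL : ∀ x ∈ B, ∀ y ∈ B, (y : ℝ) - x ≤ L) :
    (B.card : ℝ) ≤ r.divisors.card * (1 + 2 * Int.gcd m r * L / r) := by
  rcases B.eq_empty_or_nonempty with rfl | ⟨q₀, hq₀⟩
  · simp; positivity
  have hr' : (0 : ℝ) < r := by exact_mod_cast hr
  have hr0 : r ≠ 0 := hr.ne'
  -- Against a fixed solution `q₀`, `r` divides `(q - q₀)(q + q₀)`. With `u = gcd(q - q₀, r)` and `r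
  -- = u v` this forces `v ∣ q + q₀`, so each fibre lies in one class modulo `lcm u v`.
  have hmaps : ∀ q ∈ B, Int.gcd ((q : ℤ) - q₀) r ∈ r.divisors := fun q _ =>
    Nat.mem_divisors.2 ⟨Int.natCast_dvd_natCast.1 (Int.gcd_dvd_right _ _), hr0⟩
  rw [Finset.card_eq_sum_card_fiberwise hmaps]
  push_cast
  rw [← nsmul_eq_mul]
  refine Finset.sum_le_card_nsmul _ _ _ fun u hu => ?_
  have hur := (Nat.mem_divisors.1 hu).1
  obtain ⟨v, hv⟩ := hur
  have hu0 : 0 < u := Nat.pos_of_ne_zero (by rintro rfl; simp at hv; exact hr0 hv)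
  have hv0 : 0 < v := Nat.pos_of_ne_zero (by rintro rfl; simp at hv; exact hr0 hv)
  have hfib : ∀ q ∈ B.filter (fun q : ℕ => Int.gcd ((q : ℤ) - q₀) r = u),
      (u : ℤ) ∣ (q : ℤ) - q₀ ∧ (v : ℤ) ∣ (q : ℤ) + q₀ := by
    intro q hq
    obtain ⟨hqB, hqu⟩ := Finset.mem_filter.1 hq
    have h1 : (u : ℤ) ∣ (q : ℤ) - q₀ := hqu ▸ Int.gcd_dvd_left _ _
    refine ⟨h1, ?_⟩
    have h2 : (r : ℤ) ∣ ((q : ℤ) - q₀) * (q + q₀) := by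
      apply hp.dvd_of_dvd_mul_left
      convert! dvd_sub (hB q hqB) (hB q₀ hq₀) using 1
      ring
    obtain ⟨w, hw⟩ := h1
    have hu0' : (u : ℤ) ≠ 0 := by exact_mod_cast hu0.ne'
    have hcop : IsCoprime (v : ℤ) w := by
      rw [Int.isCoprime_iff_gcd_eq_one, Int.gcd_comm]
      rw [hw, hv, Nat.cast_mul, Int.gcd_mul_left, Int.natAbs_natCast] at hqu
      exact Nat.eq_of_mul_eq_mul_left hu0 (by rw [hqu, mul_one])
    rw [hw, hv, Nat.cast_mul, mul_assoc] at h2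
    exact hcop.dvd_of_dvd_mul_left (Int.dvd_of_mul_dvd_mul_left hu0' h2)
  rcases (B.filter (fun q : ℕ => Int.gcd ((q : ℤ) - q₀) r = u)).eq_empty_or_nonempty with h | ⟨q, hq⟩
  · rw [h]; simp; positivity
  set e := Nat.gcd u v with he
  have he0 : 0 < e := Nat.gcd_pos_of_pos_left _ hu0
  have hlcm : 0 < Nat.lcm u v := Nat.lcm_pos hu0 hv0
  have hel : (e : ℝ) * (Nat.lcm u v : ℝ) = r := by
    rw [hv]; exact_mod_cast Nat.gcd_mul_lcm u v
  have heu : (e : ℤ) ∣ u := by exact_mod_cast Nat.gcd_dvd_left u v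
  have hev : (e : ℤ) ∣ v := by exact_mod_cast Nat.gcd_dvd_right u v
  have hd0 : 0 < Int.gcd m r := Int.gcd_pos_of_ne_zero_right _ (by exact_mod_cast hr0)
  -- The modulus `lcm u v = r / e` is not much smaller than `r`: `e ∣ 2 q₀` and `e² ∣ r` give `e² ∣
  -- 4 m`, hence `e² ≤ 4 gcd(m, r)`.
  have hed : e ≤ 2 * Int.gcd m r := by
    have h2q : (e : ℤ) ∣ 2 * q₀ := by
      have := dvd_sub (hev.trans (hfib q hq).2) (heu.trans (hfib q hq).1)
      convert! this using 1
      ring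
    have her : (e : ℤ) ^ 2 ∣ r := by
      rw [hv, sq]; push_cast; exact mul_dvd_mul heu hev
    have h4m : (e : ℤ) ^ 2 ∣ 4 * m := by
      have h1 : (e : ℤ) ^ 2 ∣ 4 * (p * (q₀ : ℤ) ^ 2 + m) := (her.trans (hB q₀ hq₀)).mul_left 4
      have h2 : (e : ℤ) ^ 2 ∣ p * (2 * q₀) ^ 2 := (pow_dvd_pow_of_dvd h2q 2).mul_left p
      convert! dvd_sub h1 h2 using 1
      ring
    have h4d : (e : ℤ) ^ 2 ∣ (Int.gcd (4 * m) (4 * r) : ℤ) := Int.dvd_coe_gcd h4m (her.mul_left 4)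
    rw [Int.gcd_mul_left] at h4d
    have h5 : e ^ 2 ≤ 4 * Int.gcd m r := by
      apply Nat.le_of_dvd (by omega)
      exact_mod_cast h4d
    nlinarith
  refine (card_le_of_dvd_sub hlcm hL fun x hx y hy hxy => ⟨?_, ?_⟩).trans ?_
  · have hx' := hfib x hx
    have hy' := hfib y hy
    apply Nat.lcm_dvd
    · zify [hxy]
      convert! dvd_sub hy'.1 hx'.1 using 1
      ring
    · zify [hxy]
      convert! dvd_sub hy'.2 hx'.2 using 1
      ring
  · exact hBL x (Finset.mem_filter.1 hx).1 y (Finset.mem_filter.1 hy).1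
  · have hl' : (0 : ℝ) < Nat.lcm u v := by exact_mod_cast hlcm
    have h1 : L / (Nat.lcm u v : ℝ) = e * L / r := by
      rw [← hel]; field_simp
    have h2 : (e : ℝ) ≤ 2 * Int.gcd m r := by exact_mod_cast hed
    rw [h1, add_comm]
    gcongr

/-- Excluding `0` removes the usual `+ 1`, so that the saving `1 / d` can cancel a factor `d =
gcd(m, r)` later. -/
theorem card_ne_zero_dvd_le {S : Finset ℤ} {d : ℕ} (hd : 0 < d) {X : ℝ} (hX : 0 ≤ X)
    (hS : ∀ m ∈ S, m ≠ 0 ∧ (d : ℤ) ∣ m ∧ |(m : ℝ)| ≤ X) : (S.card : ℝ) ≤ 2 * X / d := by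
  have hd' : (0 : ℝ) < d := by exact_mod_cast hd
  have hn : 0 ≤ ⌊X / d⌋ := Int.floor_nonneg.2 (by positivity)
  have hcard : S.card ≤ ((Finset.Icc (-⌊X / d⌋) ⌊X / d⌋).erase 0).card := by
    apply Finset.card_le_card_of_injOn (fun m : ℤ => m / (d : ℤ))
    · intro m hm
      obtain ⟨h0, ⟨k, rfl⟩, hX⟩ := hS m hm
      have hk : |(k : ℝ)| ≤ X / d := by
        rw [le_div_iff₀ hd']
        push_cast at hX
        rwa [abs_mul, abs_of_pos hd', mul_comm] at hX
      have hk' : |k| ≤ ⌊X / d⌋ := Int.le_floor.2 (by push_cast; exact hk)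
      have hd0 : (d : ℤ) ≠ 0 := by exact_mod_cast hd.ne'
      simp only [Finset.coe_erase, Finset.coe_Icc, Int.mul_ediv_cancel_left _ hd0]
      exact ⟨abs_le.1 hk', right_ne_zero_of_mul h0⟩
    · intro m hm n hn hmn
      have h1 := Int.ediv_mul_cancel (hS m hm).2.1
      have h2 := Int.ediv_mul_cancel (hS n hn).2.1
      simp only at hmn
      rw [← h1, hmn, h2]
  rw [Finset.card_erase_of_mem (by simp [hn]), Int.card_Icc] at hcard
  have h2 : (S.card : ℤ) ≤ 2 * ⌊X / d⌋ := by omega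
  have h3 : (S.card : ℝ) ≤ 2 * ⌊X / d⌋ := by exact_mod_cast h2
  rw [mul_div_assoc]
  linarith [Int.floor_le (X / d)]

/-! ### Counting fractions with square denominator in an interval -/

/-- `A` consists of pairs `(q, b)` with `q ≤ Q`, `(b, q) = 1` and `c ≤ b / q² ≤ c + δ`. -/
def SquareFractionsIn (Q c δ : ℝ) (A : Finset (Σ _ : ℕ, ℕ)) : Prop :=
  ∀ x ∈ A, 1 ≤ x.1 ∧ (x.1 : ℝ) ≤ Q ∧ Nat.Coprime x.2 x.1 ∧
    (x.2 : ℝ) / (x.1 : ℝ) ^ 2 ∈ Set.Icc c (c + δ)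

/-- For each `q` the numerators lie in an interval of length `q² δ`. Efficient when `δ ≥ Q⁻²`. -/
theorem SquareFractionsIn.card_le_of_large {Q c δ : ℝ} {A : Finset (Σ _ : ℕ, ℕ)}
    (hA : SquareFractionsIn Q c δ A) (hQ : 0 ≤ Q) (hδ : 0 ≤ δ) :
    (A.card : ℝ) ≤ Q * (Q ^ 2 * δ + 1) := by
  have hmaps : ∀ x ∈ A, x.1 ∈ Finset.Icc 1 ⌊Q⌋₊ := fun x hx =>
    Finset.mem_Icc.2 ⟨(hA x hx).1, Nat.le_floor (hA x hx).2.1⟩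
  rw [Finset.card_eq_sum_card_fiberwise hmaps]
  push_cast
  have hfib : ∀ q ∈ Finset.Icc 1 ⌊Q⌋₊,
      ((A.filter (fun x => x.1 = q)).card : ℝ) ≤ Q ^ 2 * δ + 1 := by
    intro q hq
    obtain ⟨hq1, hqQ⟩ := Finset.mem_Icc.1 hq
    have hqQ' : (q : ℝ) ≤ Q := (Nat.le_floor_iff hQ).1 hqQ
    have hq0 : (0 : ℝ) < q := by exact_mod_cast hq1
    have hinj : Set.InjOn Sigma.snd (A.filter (fun x => x.1 = q) : Set (Σ _ : ℕ, ℕ)) := by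
      rintro ⟨x1, x2⟩ hx ⟨y1, y2⟩ hy hxy
      simp at hx hy hxy
      rw [hx.2, hy.2, hxy]
    rw [← Finset.card_image_of_injOn hinj]
    have h := card_le_of_dvd_sub (B := (A.filter (fun x => x.1 = q)).image Sigma.snd)
      (s := 1) (L := Q ^ 2 * δ) one_pos (by positivity) ?_
    · simpa using h
    · intro x hx y hy _
      refine ⟨one_dvd _, ?_⟩
      obtain ⟨x', hx', rfl⟩ := Finset.mem_image.1 hx
      obtain ⟨y', hy', rfl⟩ := Finset.mem_image.1 hy
      obtain ⟨hxA, hxq⟩ := Finset.mem_filter.1 hx'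
      obtain ⟨hyA, hyq⟩ := Finset.mem_filter.1 hy'
      have h1 := (hA _ hxA).2.2.2.1
      have h2 := (hA _ hyA).2.2.2.2
      rw [hxq, le_div_iff₀ (by positivity)] at h1
      rw [hyq, div_le_iff₀ (by positivity)] at h2
      have h3 : (q : ℝ) ^ 2 * δ ≤ Q ^ 2 * δ := by gcongr
      linarith
  refine (Finset.sum_le_card_nsmul _ _ _ hfib).trans ?_
  rw [Nat.card_Icc, nsmul_eq_mul, Nat.add_sub_cancel]
  have := Nat.floor_le hQ
  gcongr

/-- Both `b / q²` and `p / r` are in lowest terms, so equal values force equal numerators and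
denominators. -/
theorem SquareFractionsIn.eq_of_div_eq {Q c δ : ℝ} {A : Finset (Σ _ : ℕ, ℕ)}
    (hA : SquareFractionsIn Q c δ A) {p r : ℤ} (hr : 0 < r) (hp : IsCoprime r p)
    {x : Σ _ : ℕ, ℕ} (hx : x ∈ A) (h : (x.2 : ℤ) * r - p * (x.1 : ℤ) ^ 2 = 0) :
    (x.1 : ℤ) ^ 2 = r ∧ (x.2 : ℤ) = p := by
  have hcop : IsCoprime ((x.1 : ℤ) ^ 2) (x.2 : ℤ) :=
    (Nat.isCoprime_iff_coprime.2 (hA x hx).2.2.1).symm.pow_left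
  have h' : (x.2 : ℤ) * r = p * (x.1 : ℤ) ^ 2 := by linarith
  have h1 : r ∣ (x.1 : ℤ) ^ 2 := hp.dvd_of_dvd_mul_left (h' ▸ Dvd.intro_left _ rfl)
  have h2 : (x.1 : ℤ) ^ 2 ∣ r := hcop.dvd_of_dvd_mul_left (h' ▸ Dvd.intro_left _ rfl)
  have h3 : (x.1 : ℤ) ^ 2 = r := Int.dvd_antisymm (by positivity) hr.le h2 h1
  refine ⟨h3, ?_⟩
  rw [h3] at h'
  exact mul_right_cancel₀ hr.ne' h'

/-- Distinct fractions `b / q²` and `b' / q'²` differ by at least `1 / (q q')² ≥ Q⁻⁴`. -/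
theorem SquareFractionsIn.card_le_one_of_small {Q c δ : ℝ} {A : Finset (Σ _ : ℕ, ℕ)}
    (hA : SquareFractionsIn Q c δ A) (hδ : Q ^ 4 * δ < 1) : A.card ≤ 1 := by
  rw [Finset.card_le_one]
  intro x hx y hy
  obtain ⟨hx1, hxQ, hxc, hxI⟩ := hA x hx
  obtain ⟨hy1, hyQ, hyc, hyI⟩ := hA y hy
  have hx0 : (0 : ℝ) < x.1 := by exact_mod_cast hx1
  have hy0 : (0 : ℝ) < y.1 := by exact_mod_cast hy1
  have hy0' : 0 < (y.1 : ℤ) ^ 2 := by exact_mod_cast pow_pos hy1 2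
  have hdiff : |(x.2 : ℝ) / (x.1 : ℝ) ^ 2 - (y.2 : ℝ) / (y.1 : ℝ) ^ 2| ≤ δ := by
    rw [abs_le]
    constructor <;> linarith [hxI.1, hxI.2, hyI.1, hyI.2]
  have hdet : |(x.2 : ℝ) * (y.1 : ℝ) ^ 2 - y.2 * (x.1 : ℝ) ^ 2| < 1 := by
    have h1 : (x.2 : ℝ) * (y.1 : ℝ) ^ 2 - y.2 * (x.1 : ℝ) ^ 2 =
        (x.1 : ℝ) ^ 2 * (y.1 : ℝ) ^ 2 * ((x.2 : ℝ) / (x.1 : ℝ) ^ 2 - (y.2 : ℝ) / (y.1 : ℝ) ^ 2) := by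
      field_simp
    rw [h1, abs_mul, abs_of_pos (by positivity)]
    calc (x.1 : ℝ) ^ 2 * (y.1 : ℝ) ^ 2 * _ ≤ Q ^ 2 * Q ^ 2 * δ := by gcongr
      _ = Q ^ 4 * δ := by ring
      _ < 1 := hδ
  have hz : (x.2 : ℤ) * (y.1 : ℤ) ^ 2 - y.2 * (x.1 : ℤ) ^ 2 = 0 := by
    rw [← Int.abs_lt_one_iff]
    exact_mod_cast hdet
  have hcop : IsCoprime ((y.1 : ℤ) ^ 2) (y.2 : ℤ) :=
    (Nat.isCoprime_iff_coprime.2 hyc).symm.pow_left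
  obtain ⟨h1, h2⟩ := hA.eq_of_div_eq hy0' hcop hx hz
  have h3 : x.1 = y.1 := Nat.pow_left_injective (n := 2) (by norm_num) (by exact_mod_cast h1)
  obtain ⟨x1, x2⟩ := x
  obtain ⟨y1, y2⟩ := y
  simp at h2 h3
  rw [h2, h3]

/-- Two fractions with the same `m = b r - p q²` have deviations from `p / r` equal to `m / (r q²)`.
These differ by at most `δ`, which confines `q` to an interval whose length shrinks as `p / r` moves
away from `c`. -/
theorem SquareFractionsIn.sub_mul_le {Q c δ : ℝ} {A : Finset (Σ _ : ℕ, ℕ)}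
    (hA : SquareFractionsIn Q c δ A) (hδ : 0 < δ) {p : ℤ} {r : ℕ} (hr : 0 < r)
    {x y : Σ _ : ℕ, ℕ} (hx : x ∈ A) (hy : y ∈ A)
    (hxy : (x.2 : ℤ) * r - p * (x.1 : ℤ) ^ 2 = (y.2 : ℤ) * r - p * (y.1 : ℤ) ^ 2) :
    ((y.1 : ℝ) - x.1) * (|c - p / r| + δ) ≤ 3 * Q * δ := by
  obtain ⟨hx1, hxQ, hxc, hxI⟩ := hA x hx
  obtain ⟨hy1, hyQ, hyc, hyI⟩ := hA y hy
  have hx0 : (0 : ℝ) < x.1 := by exact_mod_cast hx1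
  have hy0 : (0 : ℝ) < y.1 := by exact_mod_cast hy1
  have hr0 : (0 : ℝ) < r := by exact_mod_cast hr
  have hQ0 : 0 < Q := hx0.trans_le hxQ
  rcases le_total (y.1 : ℝ) x.1 with hle | hle
  · refine (mul_nonpos_of_nonpos_of_nonneg (by linarith) (by positivity)).trans (by positivity)
  set θ := (x.2 : ℝ) / (x.1 : ℝ) ^ 2 - p / r with hθ
  set φ := (y.2 : ℝ) / (y.1 : ℝ) ^ 2 - p / r with hφ
  have heq : θ * (x.1 : ℝ) ^ 2 = φ * (y.1 : ℝ) ^ 2 := by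
    have h : (x.2 : ℝ) * r - p * (x.1 : ℝ) ^ 2 = (y.2 : ℝ) * r - p * (y.1 : ℝ) ^ 2 := by
      exact_mod_cast hxy
    have h1 : θ * (x.1 : ℝ) ^ 2 = ((x.2 : ℝ) * r - p * (x.1 : ℝ) ^ 2) / r := by
      rw [hθ]; field_simp
    have h2 : φ * (y.1 : ℝ) ^ 2 = ((y.2 : ℝ) * r - p * (y.1 : ℝ) ^ 2) / r := by
      rw [hφ]; field_simp
    rw [h1, h2, h]
  have habs : |θ| * (x.1 : ℝ) ^ 2 = |φ| * (y.1 : ℝ) ^ 2 := by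
    have := congrArg abs heq
    rwa [abs_mul, abs_mul, abs_of_pos (pow_pos hx0 2), abs_of_pos (pow_pos hy0 2)] at this
  have hdiff : |θ| - |φ| ≤ δ := by
    refine (abs_sub_abs_le_abs_sub _ _).trans ?_
    rw [abs_le]
    constructor <;> linarith [hxI.1, hxI.2, hyI.1, hyI.2]
  have hc : |c - p / r| ≤ |φ| + δ := by
    have h1 : |c - p / r - φ| ≤ δ := by
      rw [abs_le]
      constructor <;> linarith [hyI.1, hyI.2]
    linarith [abs_sub_abs_le_abs_sub (c - p / r) φ]
  have h1 : |φ| * ((y.1 : ℝ) - x.1) * (y.1 + x.1) ≤ (x.1 * δ) * (y.1 + x.1) := by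
    have : |φ| * ((y.1 : ℝ) - x.1) * (y.1 + x.1) = (x.1 : ℝ) ^ 2 * (|θ| - |φ|) := by linarith
    rw [this]
    have : (x.1 : ℝ) ^ 2 * (|θ| - |φ|) ≤ (x.1 : ℝ) ^ 2 * δ := by gcongr
    nlinarith [mul_pos (mul_pos hx0 hδ) hy0]
  have h2 : |φ| * ((y.1 : ℝ) - x.1) ≤ x.1 * δ := le_of_mul_le_mul_right h1 (by positivity)
  have h3 : (x.1 : ℝ) * δ ≤ Q * δ := by gcongr
  have h4 : ((y.1 : ℝ) - x.1) * (|c - p / r| + δ) ≤ ((y.1 : ℝ) - x.1) * (|φ| + 2 * δ) := by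
    apply mul_le_mul_of_nonneg_left _ (by linarith)
    linarith
  have h5 : ((y.1 : ℝ) - x.1) * δ ≤ Q * δ := by
    apply mul_le_mul_of_nonneg_right _ hδ.le
    linarith
  nlinarith

/-- The `1` counts `m = 0`. The rest sums the congruence bound over the nonzero `|m| ≤ X`, with `q`
in an interval of length `L`; the product `X L / r = 3 Q³ δ` does not depend on the approximation.
-/
theorem SquareFractionsIn.card_le {Q c δ : ℝ} {A : Finset (Σ _ : ℕ, ℕ)}
    (hA : SquareFractionsIn Q c δ A) (hQ : 0 ≤ Q) (hδ : 0 < δ) {p : ℤ} {r : ℕ} (hr : 0 < r)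
    (hp : IsCoprime (r : ℤ) p) :
    (A.card : ℝ) ≤ 1 + (r.divisors.card : ℝ) ^ 2 *
      (2 * Q ^ 2 * (r * (|c - p / r| + δ)) + 12 * Q ^ 3 * δ) := by
  have hr0 : (0 : ℝ) < r := by exact_mod_cast hr
  set Z := |c - p / r| + δ with hZ
  have hZ0 : 0 < Z := by positivity
  set X := r * Q ^ 2 * Z with hX
  set L := 3 * Q * δ / Z with hL
  have hL0 : 0 ≤ L := by positivity
  have hX0 : 0 ≤ X := by positivity
  set μ : (Σ _ : ℕ, ℕ) → ℤ := fun x => (x.2 : ℤ) * r - p * (x.1 : ℤ) ^ 2 with hμ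
  set τ : ℝ := (r.divisors.card : ℝ) with hτ
  have hμX : ∀ x ∈ A, |(μ x : ℝ)| ≤ X := by
    intro x hx
    obtain ⟨hx1, hxQ, -, hxI⟩ := hA x hx
    have hx0 : (0 : ℝ) < x.1 := by exact_mod_cast hx1
    have h1 : (μ x : ℝ) = r * (x.1 : ℝ) ^ 2 * ((x.2 : ℝ) / (x.1 : ℝ) ^ 2 - p / r) := by
      simp only [hμ]; push_cast; field_simp
    have h2 : |(x.2 : ℝ) / (x.1 : ℝ) ^ 2 - p / r| ≤ Z := by
      have h3 : |(x.2 : ℝ) / (x.1 : ℝ) ^ 2 - c| ≤ δ := by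
        rw [abs_le]
        constructor <;> linarith [hxI.1, hxI.2]
      have := abs_add_le ((x.2 : ℝ) / (x.1 : ℝ) ^ 2 - c) (c - p / r)
      rw [sub_add_sub_cancel] at this
      linarith
    rw [h1, abs_mul, abs_of_pos (by positivity : (0 : ℝ) < r * (x.1 : ℝ) ^ 2), hX]
    gcongr
  have hzero : (A.filter (fun x => μ x = 0)).card ≤ 1 := by
    rw [Finset.card_le_one]
    intro x hx y hy
    obtain ⟨hxA, hx0⟩ := Finset.mem_filter.1 hx
    obtain ⟨hyA, hy0⟩ := Finset.mem_filter.1 hy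
    obtain ⟨h1, h2⟩ := hA.eq_of_div_eq (by exact_mod_cast hr) hp hxA hx0
    obtain ⟨h3, h4⟩ := hA.eq_of_div_eq (by exact_mod_cast hr) hp hyA hy0
    have h5 : x.1 = y.1 :=
      Nat.pow_left_injective (n := 2) (by norm_num) (by exact_mod_cast h1.trans h3.symm)
    have h6 : x.2 = y.2 := by exact_mod_cast h2.trans h4.symm
    obtain ⟨x1, x2⟩ := x
    obtain ⟨y1, y2⟩ := y
    simp at h5 h6
    rw [h5, h6]
  set A' := A.filter (fun x => ¬ μ x = 0) with hA'
  have hfib : ∀ m ∈ A'.image μ, ((A'.filter (fun x => μ x = m)).card : ℝ) ≤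
      τ * (1 + 2 * Int.gcd m r * L / r) := by
    intro m _
    have hmem : ∀ x ∈ A'.filter (fun x => μ x = m), x ∈ A ∧ μ x = m := fun x hx =>
      ⟨(Finset.mem_filter.1 (Finset.mem_filter.1 hx).1).1, (Finset.mem_filter.1 hx).2⟩
    have hinj : Set.InjOn Sigma.fst (A'.filter (fun x => μ x = m) : Set (Σ _ : ℕ, ℕ)) := by
      rintro ⟨x1, x2⟩ hx ⟨y1, y2⟩ hy hxy
      have h1 := (hmem _ hx).2
      have h2 := (hmem _ hy).2
      simp only [hμ] at h1 h2 hxy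
      subst hxy
      have h3 : (x2 : ℤ) * r = y2 * r := by linarith
      have h4 : (x2 : ℤ) = y2 := mul_right_cancel₀ (by exact_mod_cast hr.ne') h3
      have h5 : x2 = y2 := by exact_mod_cast h4
      rw [h5]
    rw [← Finset.card_image_of_injOn hinj]
    refine card_quadratic_congruence_le hr hp ?_ hL0 ?_
    · intro q hq
      obtain ⟨x, hx, rfl⟩ := Finset.mem_image.1 hq
      rw [← (hmem x hx).2]
      exact ⟨x.2, by simp only [hμ]; ring⟩
    · intro q hq q' hq'
      obtain ⟨x, hx, rfl⟩ := Finset.mem_image.1 hq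
      obtain ⟨y, hy, rfl⟩ := Finset.mem_image.1 hq'
      rw [hL, le_div_iff₀ hZ0]
      exact hA.sub_mul_le hδ hr (hmem x hx).1 (hmem y hy).1
        ((hmem x hx).2.trans (hmem y hy).2.symm)
  have hmaps : ∀ m ∈ A'.image μ, Int.gcd m r ∈ r.divisors := fun m _ =>
    Nat.mem_divisors.2 ⟨Int.natCast_dvd_natCast.1 (Int.gcd_dvd_right _ _), hr.ne'⟩
  have hmain : (A'.card : ℝ) ≤ τ * (τ * (2 * X + 4 * X * L / r)) := by
    rw [Finset.card_eq_sum_card_image μ A']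
    push_cast
    refine (Finset.sum_le_sum hfib).trans ?_
    -- Group the `m` by `d = gcd(m, r)`: at most `2 X / d` values occur, cancelling the `d` in the
    -- congruence bound.
    rw [← Finset.sum_fiberwise_of_maps_to hmaps, hτ, ← nsmul_eq_mul]
    refine Finset.sum_le_card_nsmul _ _ _ fun d hd => ?_
    have hd0 : 0 < d := Nat.pos_of_mem_divisors hd
    have hd1 : (1 : ℝ) ≤ d := by exact_mod_cast hd0
    have h1 : ∀ m ∈ (A'.image μ).filter (fun m => Int.gcd m r = d),
        τ * (1 + 2 * Int.gcd m r * L / r) ≤ τ * (1 + 2 * d * L / r) := by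
      intro m hm
      rw [(Finset.mem_filter.1 hm).2]
    refine (Finset.sum_le_card_nsmul _ _ _ h1).trans ?_
    rw [nsmul_eq_mul]
    have h2 : (((A'.image μ).filter (fun m => Int.gcd m r = d)).card : ℝ) ≤ 2 * X / d := by
      refine card_ne_zero_dvd_le hd0 hX0 fun m hm => ?_
      obtain ⟨hm1, hm2⟩ := Finset.mem_filter.1 hm
      obtain ⟨x, hx, rfl⟩ := Finset.mem_image.1 hm1
      obtain ⟨hxA, hx0⟩ := Finset.mem_filter.1 hx
      exact ⟨hx0, hm2 ▸ Int.gcd_dvd_left _ _, hμX x hxA⟩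
    calc _ ≤ 2 * X / d * (τ * (1 + 2 * d * L / r)) := by gcongr
      _ = τ * (2 * X / d + 4 * X * L / r) := by field_simp; ring
      _ ≤ τ * (2 * X + 4 * X * L / r) := by
        gcongr
        exact div_le_self (by positivity) hd1
  have hsplit : (A.card : ℝ) = (A.filter (fun x => μ x = 0)).card + A'.card := by
    rw [hA']
    exact_mod_cast (Finset.card_filter_add_card_filter_not (s := A) (fun x => μ x = 0)).symm
  have hzero' : ((A.filter (fun x => μ x = 0)).card : ℝ) ≤ 1 := by exact_mod_cast hzero
  have hXL : 4 * X * L / r = 12 * Q ^ 3 * δ := by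
    rw [hX, hL]; field_simp; ring
  rw [hsplit]
  refine (add_le_add hzero' hmain).trans (le_of_eq ?_)
  rw [hXL, hX]
  ring

/-! ### The divisor bound -/

/-- The divisor bound. -/
theorem exists_card_divisors_le (ε : ℝ) (hε : 0 < ε) :
    ∃ C : ℝ, 1 ≤ C ∧ ∀ n : ℕ, 0 < n → (n.divisors.card : ℝ) ≤ C * (n : ℝ) ^ ε := by
  have hlog : 0 < ε * Real.log 2 := mul_pos hε (Real.log_pos (by norm_num))
  -- `D` is the loss allowed at each prime below `B`. For `p ≥ B ≥ 2 ^ (1 / ε)` there is none, as `k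
  -- + 1 ≤ 2 ^ k ≤ p ^ (k ε)`.
  set D : ℝ := 1 + 1 / (ε * Real.log 2) with hD
  have hD1 : 1 ≤ D := by rw [hD]; linarith [one_div_pos.2 hlog]
  set B : ℕ := ⌈(2 : ℝ) ^ (1 / ε)⌉₊ with hB
  have hsmall : ∀ (p k : ℕ), 2 ≤ p → ((k + 1 : ℕ) : ℝ) ≤ D * ((p : ℝ) ^ k) ^ ε := by
    intro p k hp
    have hp' : (2 : ℝ) ≤ p := by exact_mod_cast hp
    have h1 : ε * Real.log 2 * k + 1 ≤ ((p : ℝ) ^ k) ^ ε := by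
      rw [← Real.rpow_natCast, ← Real.rpow_mul (by positivity),
        Real.rpow_def_of_pos (by linarith)]
      refine (Real.add_one_le_exp _).trans (Real.exp_le_exp.2 ?_)
      have : Real.log 2 ≤ Real.log p := Real.log_le_log (by norm_num) hp'
      calc ε * Real.log 2 * k = Real.log 2 * (k * ε) := by ring
        _ ≤ _ := by gcongr
    have h2 : D * (ε * Real.log 2 * k + 1) = k + 1 + ε * Real.log 2 * k + 1 / (ε * Real.log 2) := by
      rw [hD]
      field_simp
      ring
    have h3 : 0 ≤ ε * Real.log 2 * k := by positivity
    have h4 := one_div_pos.2 hlog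
    have h5 : D * (ε * Real.log 2 * k + 1) ≤ D * ((p : ℝ) ^ k) ^ ε := by gcongr
    push_cast
    linarith
  have hlarge : ∀ (p k : ℕ), B ≤ p → ((k + 1 : ℕ) : ℝ) ≤ ((p : ℝ) ^ k) ^ ε := by
    intro p k hp
    have hp' : (2 : ℝ) ^ (1 / ε) ≤ p := (Nat.le_ceil _).trans (by exact_mod_cast hp)
    have h2 : (2 : ℝ) ≤ (p : ℝ) ^ ε := by
      have := Real.rpow_le_rpow (by positivity) hp' hε.le
      rwa [← Real.rpow_mul (by norm_num), one_div_mul_cancel hε.ne', Real.rpow_one] at this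
    rw [← Real.rpow_natCast, ← Real.rpow_mul (by positivity), mul_comm,
      Real.rpow_mul (by positivity), Real.rpow_natCast]
    calc ((k + 1 : ℕ) : ℝ) ≤ ((2 ^ k : ℕ) : ℝ) := by exact_mod_cast Nat.lt_two_pow_self
      _ = (2 : ℝ) ^ k := by push_cast; rfl
      _ ≤ _ := by gcongr
  refine ⟨D ^ B, one_le_pow₀ hD1, fun n hn => ?_⟩
  have hn0 : n ≠ 0 := hn.ne'
  rw [Nat.card_divisors hn0]
  have hprod : (n : ℝ) ^ ε = ∏ p ∈ n.primeFactors, ((p : ℝ) ^ n.factorization p) ^ ε := by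
    rw [Real.finsetProd_rpow _ _ fun p _ => by positivity]
    congr 1
    conv_lhs => rw [← Nat.prod_factorization_pow_eq_self hn0]
    simp [Finsupp.prod]
  have hterm : ∀ p ∈ n.primeFactors, ((n.factorization p + 1 : ℕ) : ℝ) ≤
      (if p < B then D else 1) * ((p : ℝ) ^ n.factorization p) ^ ε := by
    intro p hp
    split_ifs with h
    · exact hsmall p _ (Nat.prime_of_mem_primeFactors hp).two_le
    · rw [one_mul]
      exact hlarge p _ (not_lt.1 h)
  push_cast at hterm ⊢
  refine (Finset.prod_le_prod (fun p _ => by positivity) hterm).trans ?_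
  rw [Finset.prod_mul_distrib, ← hprod, Finset.prod_ite, Finset.prod_const, Finset.prod_const_one,
    mul_one]
  have hcard : (n.primeFactors.filter (· < B)).card ≤ B := by
    calc _ ≤ (Finset.range B).card := Finset.card_le_card fun p hp => by
          simpa using (Finset.mem_filter.1 hp).2
      _ = B := Finset.card_range B
  gcongr


/-! ### Dirichlet approximation and conclusion -/

theorem SquareFractionsIn.card_mul_le {Q c ε C : ℝ} {M : ℕ} {A : Finset (Σ _ : ℕ, ℕ)}
    (hA : SquareFractionsIn Q c (1 / M) A) (hQ : 1 ≤ Q) (hM : 0 < M) (hε : 0 < ε) (hC1 : 1 ≤ C)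
    (hC : ∀ n : ℕ, 0 < n → (n.divisors.card : ℝ) ≤ C * (n : ℝ) ^ ε) :
    (A.card : ℝ) * M ≤ 2 * Q ^ 3 + M + 17 * C ^ 2 * (M : ℝ) ^ (1 / 2 + ε) * Q ^ 2 := by
  have hQ0 : 0 < Q := by linarith
  have hM0 : (0 : ℝ) < M := by exact_mod_cast hM
  have hM1 : (1 : ℝ) ≤ M := by exact_mod_cast hM
  have hpow : 0 ≤ 17 * C ^ 2 * (M : ℝ) ^ (1 / 2 + ε) * Q ^ 2 := by positivity
  have hQ3 : 0 < Q ^ 3 := by positivity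
  rcases le_or_gt (M : ℝ) (Q ^ 2) with hlarge | hlarge
  · have h := hA.card_le_of_large hQ0.le (by positivity)
    have h1 : (A.card : ℝ) * M ≤ Q * (Q ^ 2 * (1 / M) + 1) * M := by gcongr
    have h2 : Q * (Q ^ 2 * (1 / M) + 1) * M = Q ^ 3 + Q * M := by field_simp
    have h3 : Q * M ≤ Q * Q ^ 2 := by gcongr
    have h4 : Q * Q ^ 2 = Q ^ 3 := by ring
    linarith
  rcases lt_or_ge (Q ^ 4) (M : ℝ) with hsmall | hsmall
  · have h := hA.card_le_one_of_small (by rwa [mul_one_div, div_lt_one hM0])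
    have h1 : (A.card : ℝ) ≤ 1 := by exact_mod_cast h
    have h2 : (A.card : ℝ) * M ≤ 1 * M := by gcongr
    linarith
  set s := Real.sqrt M with hs
  have hs0 : 0 < s := Real.sqrt_pos.2 hM0
  have hs2 : s ^ 2 = M := Real.sq_sqrt hM0.le
  have hQs : Q ≤ s := Real.le_sqrt_of_sq_le hlarge.le
  have hsQ : s ≤ Q ^ 2 := Real.sqrt_le_iff.2 ⟨by positivity, by rw [← pow_mul]; exact hsmall⟩
  -- Denominators up to `⌊√M⌋` balance the two parts of `r (|c - p / r| + 1 / M)`: each is at most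
  -- `1 / √M`.
  obtain ⟨x, hx, hden⟩ := Real.exists_rat_abs_sub_le_and_den_le c (Nat.sqrt_pos.2 hM)
  have hr : 0 < x.den := x.den_pos
  have hr0 : (0 : ℝ) < x.den := by exact_mod_cast hr
  have hcop : IsCoprime (x.den : ℤ) x.num := by
    rw [Int.isCoprime_iff_gcd_eq_one, Int.gcd_comm]
    exact x.reduced
  have hcount := hA.card_le hQ0.le (by positivity) hr hcop
  rw [Rat.cast_def] at hx
  have hr2 : (x.den : ℝ) ^ 2 ≤ M := by
    have : x.den ^ 2 ≤ M := (Nat.pow_le_pow_left hden 2).trans (Nat.sqrt_le' M)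
    exact_mod_cast this
  have hrs : (x.den : ℝ) ≤ s := Real.le_sqrt_of_sq_le hr2
  have hsn : s ≤ (Nat.sqrt M : ℝ) + 1 := by
    apply Real.sqrt_le_iff.2 ⟨by positivity, ?_⟩
    exact_mod_cast (Nat.lt_succ_sqrt' M).le
  have hrZ : (x.den : ℝ) * (|c - x.num / x.den| + 1 / M) ≤ 2 / s := by
    have h1 : (x.den : ℝ) * |c - x.num / x.den| ≤ 1 / s := by
      calc _ ≤ (x.den : ℝ) * (1 / (((Nat.sqrt M : ℕ) + 1) * x.den)) := by gcongr
        _ = 1 / ((Nat.sqrt M : ℝ) + 1) := by field_simp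
        _ ≤ 1 / s := by gcongr
    have h2 : (x.den : ℝ) * (1 / M) ≤ 1 / s := by
      calc _ ≤ s * (1 / M) := by gcongr
        _ = 1 / s := by rw [← hs2]; field_simp
    have h3 : 2 / s = 1 / s + 1 / s := by ring
    rw [mul_add, h3]
    exact add_le_add h1 h2
  have hτ : (x.den.divisors.card : ℝ) ^ 2 ≤ C ^ 2 * (M : ℝ) ^ ε := by
    calc (x.den.divisors.card : ℝ) ^ 2 ≤ (C * (x.den : ℝ) ^ ε) ^ 2 := by
          gcongr; exact hC _ hr
      _ = C ^ 2 * ((x.den : ℝ) ^ 2) ^ ε := by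
          rw [mul_pow, ← Real.rpow_natCast, ← Real.rpow_natCast, ← Real.rpow_natCast,
            ← Real.rpow_mul hr0.le, ← Real.rpow_mul hr0.le, mul_comm ε]
      _ ≤ C ^ 2 * (M : ℝ) ^ ε := by gcongr
  set D := C ^ 2 * (M : ℝ) ^ ε with hD
  have hD1 : 1 ≤ D := one_le_mul_of_one_le_of_one_le (one_le_pow₀ hC1) (Real.one_le_rpow hM1 hε.le)
  have hcube : 12 * Q ^ 3 * (1 / M) ≤ 12 * (Q ^ 2 / s) := by
    calc 12 * Q ^ 3 * (1 / M) = 12 * (Q ^ 2 * Q * (1 / M)) := by ring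
      _ ≤ 12 * (Q ^ 2 * s * (1 / M)) := by gcongr
      _ = 12 * (Q ^ 2 / s) := by rw [← hs2]; field_simp
  -- As `√M ≤ Q²` here, the lone `m = 0` fraction is absorbed: `17 = 1 + 4 + 12`.
  have hone : 1 ≤ D * (Q ^ 2 / s) :=
    one_le_mul_of_one_le_of_one_le hD1 ((one_le_div hs0).2 hsQ)
  have hcount' : (A.card : ℝ) ≤ 17 * D * (Q ^ 2 / s) := by
    calc (A.card : ℝ) ≤ _ := hcount
      _ ≤ D * (Q ^ 2 / s) + D * (2 * Q ^ 2 * (2 / s) + 12 * (Q ^ 2 / s)) := by gcongr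
      _ = 17 * D * (Q ^ 2 / s) := by ring
  have hfin : (A.card : ℝ) * M ≤ 17 * C ^ 2 * (M : ℝ) ^ (1 / 2 + ε) * Q ^ 2 := by
    calc (A.card : ℝ) * M ≤ 17 * D * (Q ^ 2 / s) * M := by gcongr
      _ = 17 * D * Q ^ 2 * s := by rw [← hs2]; field_simp
      _ = _ := by rw [Real.rpow_add hM0, ← Real.sqrt_eq_rpow, ← hs, hD]; ring
  linarith

theorem one_fourth_le_log_log_sq {x : ℝ} (hx : 10 ≤ x) :
    1 / 4 ≤ (Real.log (Real.log x)) ^ 2 := by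
  have h1 : 2 ≤ Real.log x := by
    rw [Real.le_log_iff_exp_le (by linarith), show (2 : ℝ) = 1 + 1 by norm_num, Real.exp_add]
    nlinarith [Real.exp_one_lt_d9, Real.exp_pos 1]
  have h2 : Real.log 2 ≤ Real.log (Real.log x) := Real.log_le_log (by norm_num) h1
  nlinarith [Real.log_two_gt_d9]

theorem theorem3 (ε : ℝ) (hε : 0 < ε) :
    ∃ C : ℝ, 0 < C ∧ ∀ (N Q Q₁ : ℝ) (a : ℕ → ℂ), 1 ≤ N → 1 ≤ Q → 1 ≤ Q₁ →
      squareSieveSum a N Q₁ ≤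
        C * (Real.log (Real.log (10 * N * Q))) ^ 2 *
          (Q₁ ^ 3 + N + N ^ (1 / 2 + ε) * Q₁ ^ 2) * sqNormSum a N := by
  obtain ⟨C, hC1, hC⟩ := exists_card_divisors_le ε hε
  set R : ℝ := 2 + 17 * C ^ 2 * (2 : ℝ) ^ (1 / 2 + ε) with hR
  have hR2 : 2 ≤ R := by
    rw [hR]
    linarith [show 0 ≤ 17 * C ^ 2 * (2 : ℝ) ^ (1 / 2 + ε) by positivity]
  -- `168 = 42 * 4`, the `4` paying for `(log log)² ≥ 1 / 4`; `R` includes the cost of replacing `M`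
  -- by `2 N`.
  refine ⟨168 * R, by linarith, fun N Q Q₁ a hN hQ hQ₁ => ?_⟩
  have hN0 : 0 < N := by linarith
  set M : ℕ := ⌊N⌋₊ + 1 with hM
  have hNM : N ≤ M := by rw [hM]; push_cast; exact (Nat.lt_floor_add_one N).le
  have hM2 : (M : ℝ) ≤ 2 * N := by
    rw [hM]; push_cast; linarith [Nat.floor_le hN0.le]
  have hMpos : 0 < M := Nat.succ_pos _
  have hM0 : (0 : ℝ) < M := by exact_mod_cast hMpos
  set W := Q₁ ^ 3 + N + N ^ (1 / 2 + ε) * Q₁ ^ 2 with hW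
  have hNpow : 0 ≤ N ^ (1 / 2 + ε) * Q₁ ^ 2 := by positivity
  have hQ3 : 0 ≤ Q₁ ^ 3 := by positivity
  have hW0 : 0 ≤ W := by positivity
  have hZ := sqNormSum_nonneg a N
  have hbound : 2 * Q₁ ^ 3 + M + 17 * C ^ 2 * (M : ℝ) ^ (1 / 2 + ε) * Q₁ ^ 2 ≤ R * W := by
    have h1 : (M : ℝ) ^ (1 / 2 + ε) ≤ (2 : ℝ) ^ (1 / 2 + ε) * N ^ (1 / 2 + ε) := by
      rw [← Real.mul_rpow (by norm_num) hN0.le]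
      gcongr
    calc 2 * Q₁ ^ 3 + M + 17 * C ^ 2 * (M : ℝ) ^ (1 / 2 + ε) * Q₁ ^ 2
        ≤ 2 * Q₁ ^ 3 + 2 * N +
          17 * C ^ 2 * ((2 : ℝ) ^ (1 / 2 + ε) * N ^ (1 / 2 + ε)) * Q₁ ^ 2 := by gcongr
      _ = 2 * (Q₁ ^ 3 + N) + (R - 2) * (N ^ (1 / 2 + ε) * Q₁ ^ 2) := by rw [hR]; ring
      _ ≤ R * (Q₁ ^ 3 + N) + R * (N ^ (1 / 2 + ε) * Q₁ ^ 2) := by gcongr; linarith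
      _ = R * W := by rw [hW]; ring
  have hsieve : squareSieveSum a N Q₁ ≤ 42 * (R * W) * sqNormSum a N := by
    unfold squareSieveSum
    rw [Finset.sum_sigma']
    have hmem : ∀ x ∈ (Finset.Icc 1 ⌊Q₁⌋₊).sigma
        (fun q => (Finset.Icc 1 (q ^ 2)).filter (fun b => Nat.Coprime b q)),
        1 ≤ x.1 ∧ (x.1 : ℝ) ≤ Q₁ ∧ Nat.Coprime x.2 x.1 ∧ 1 ≤ x.2 ∧ x.2 ≤ x.1 ^ 2 := by
      intro x hx
      simp only [Finset.mem_sigma, Finset.mem_filter, Finset.mem_Icc] at hx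
      exact ⟨hx.1.1, (Nat.le_floor_iff (by linarith)).1 hx.1.2, hx.2.2, hx.2.1⟩
    have h := sum_norm_sq_expSum_le a hN0.le hMpos hNM
      ((Finset.Icc 1 ⌊Q₁⌋₊).sigma (fun q => (Finset.Icc 1 (q ^ 2)).filter (Nat.Coprime · q)))
      (fun x => (x.2 : ℝ) / (x.1 : ℝ) ^ 2) (K := R * W / M) ?_ ?_
    · rwa [div_mul_cancel₀ _ hM0.ne'] at h
    · intro x hx
      obtain ⟨h1, -, -, h2, h3⟩ := hmem x hx
      have h1' : (0 : ℝ) < x.1 := by exact_mod_cast h1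
      have h2' : (0 : ℝ) < x.2 := by exact_mod_cast h2
      refine ⟨by positivity, (div_le_one (by positivity)).2 (by exact_mod_cast h3)⟩
    · intro c A hAT hAI
      rw [le_div_iff₀ hM0]
      refine (SquareFractionsIn.card_mul_le (c := c) (fun x hx => ?_) hQ₁ hMpos hε hC1 hC).trans
        hbound
      obtain ⟨h1, h2, h3, -⟩ := hmem x (hAT hx)
      exact ⟨h1, h2, h3, hAI x hx⟩
  have hlog : 1 / 4 ≤ (Real.log (Real.log (10 * N * Q))) ^ 2 := by
    apply one_fourth_le_log_log_sq
    have : 1 ≤ N * Q := one_le_mul_of_one_le_of_one_le hN hQ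
    linarith
  calc squareSieveSum a N Q₁ ≤ 42 * (R * W) * sqNormSum a N := hsieve
    _ = 168 * R * (1 / 4) * W * sqNormSum a N := by ring
    _ ≤ 168 * R * (Real.log (Real.log (10 * N * Q))) ^ 2 * W * sqNormSum a N := by gcongr
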